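/- For every positive integer $d$ there are constants $K, C > 0$, depending only on $d$, such that the following holds. Let $s \ge 0$ be an integer with $d \ge s+13$, let $0<\delta<1/2$, and let $p$ be a prime with $p \ge K\delta^{-C}$. Let $g\colon \mathbb{Z}^d\to\mathbb{Z}$ be an integer-valued polynomial of degree at most $s$, i.e. a polynomial with real coefficients of total degree at most $s$ that maps $\mathbb{Z}^d$ into $\mathbb{Z}$. Let $r\in\mathbb{F}_p$, let $\Omega=\{n\in\mathbb{F}_p^d : n\cdot n=r\}$, where $n\cdot n = n_1^2+\dots+n_d^2$, and let $\tau\colon\mathbb{F}_p^d\to\{0,\dots,p-1\}^d\subseteq\mathbb{Z}^d$ be the map that sends each coordinate to its representative in $\{0,\dots,p-1\}$. Then $\Omega$ is non-empty, and either $$\Bigl|\frac{1}{|\Omega|}\sum_{n\in\Omega} e^{2\pi i\, g(\tau(n))/p}\Bigr|<\delta,$$ or $g(\tau(n))/p \bmod \mathbb{Z}$ is constant on $\Omega$. -/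

import Mathlib

/-- The natural map `τ` from `F_p^d` to `{0, …, p-1}^d ⊆ ℤ^d`. -/
def tau {p d : ℕ} (n : Fin d → ZMod p) : Fin d → ℤ := fun i => ((n i).val : ℤ)

/-- The sphere `{n ∈ F_p^d : n · n = r}`. -/
def sphere (p d : ℕ) [Fact p.Prime] (r : ZMod p) : Finset (Fin d → ZMod p) :=
  Finset.univ.filter fun n => n ⬝ᵥ n = r

/-- `e(x) = exp(2πix)`. -/
noncomputable def e (x : ℝ) : ℂ := Complex.exp (2 * Real.pi * Complex.I * x)

/-- `g : ℤ^d → ℤ` is an integer-valued polynomial of degree at most `s`: it is the restriction to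
`ℤ^d` of a polynomial with real coefficients (which need not be integers) of total degree at most
`s`. -/
def IsIntValuedPoly {d : ℕ} (s : ℕ) (g : (Fin d → ℤ) → ℤ) : Prop :=
  ∃ P : MvPolynomial (Fin d) ℝ, P.totalDegree ≤ s ∧
    ∀ n : Fin d → ℤ, MvPolynomial.eval (fun i => (n i : ℝ)) P = (g n : ℝ)

/-!
The proof is elementary: the only estimate for character sums is Weyl differencing in one variable.

Since `s < p`, Lagrange interpolation turns `g` modulo `p` into a polynomial `f` over `𝔽_p` whose
degree is bounded in terms of `d` (`IsIntValuedPoly.exists_mvPolynomial_zmod`). The form `n · n` in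
three variables contains a hyperbolic plane, because `-1` is a sum of two squares in `𝔽_p`, so after
a linear change of coordinates the sphere is a quadric `c₀ c₁ = q(u)` with `q` quadratic and taking
every value. Where `c₀ ≠ 0` the quadric is the graph of `c₁ = q(u) / c₀`, and up to a power of `c₀`
the function `f` becomes a polynomial in the free parameters `(c₀, u)`.

If for some `c₀ ≠ 0` this function is not constant in `u`, fix a direction `w` in which it varies.
By Schwartz-Zippel it then varies along all but a proportion `O(1 / p)` of the lines
`(c₀, u + t w)`, and Weyl's inequality on each of these lines gives a power saving in `p` for the
average over the quadric (`norm_sum_splitQuadric_le`). This also holds with `c₀` and `c₁`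
interchanged. In the remaining case `f` depends only on `c₀` where `c₀ ≠ 0` and only on `c₁` where
`c₁ ≠ 0`; since `q` takes every value, these two functions are equal to one constant. It extends to
the points with `c₀ = c₁ = 0` along the lines `(t, 0, u)` in the quadric
(`eval_eq_of_splitQuadric`).
-/

/-! ### Weyl sums in one variable -/

open Polynomial in
/-- The difference `P(t + h) - P(t)` of a polynomial of degree `k + 2` has degree exactly `k + 1`
when `h ≠ 0` and `k + 2` is less than the characteristic. -/
theorem natDegree_taylor_sub_self {p : ℕ} [Fact p.Prime] {P : (ZMod p)[X]} {k : ℕ}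
    (hk : P.natDegree = k + 2) (hkp : k + 2 < p) {h : ZMod p} (hh : h ≠ 0) :
    (taylor h P - P).natDegree = k + 1 := by
  have hP : P ≠ 0 := by rintro rfl; simp at hk
  apply le_antisymm
  · have h1 := degree_sub_lt_left (p := taylor h P) (q := P) (degree_taylor P h)
      (by rwa [Ne, taylor_eq_zero]) (leadingCoeff_taylor ..)
    rw [degree_taylor, degree_eq_natDegree hP, hk] at h1
    by_cases h0 : taylor h P - P = 0
    · simp [h0]
    · have := (natDegree_lt_iff_degree_lt h0).2 h1
      omega
  · apply le_natDegree_of_ne_zero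
    have hd : (hasseDeriv (k + 1) P).natDegree < 2 := by
      have := natDegree_hasseDeriv_le P (k + 1)
      omega
    rw [coeff_sub, taylor_coeff, eval_eq_sum_range' hd]
    simp only [Finset.sum_range_succ, Finset.sum_range_zero, hasseDeriv_coeff, zero_add,
      Nat.choose_self, pow_zero, mul_one, pow_one, Nat.cast_one, one_mul, add_sub_cancel_left]
    have hl : P.coeff (k + 2) ≠ 0 := by
      rw [← hk]; exact leadingCoeff_ne_zero.2 hP
    have hc : ((Nat.choose (1 + (k + 1)) (k + 1) : ℕ) : ZMod p) ≠ 0 := by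
      rw [show 1 + (k + 1) = (k + 1) + 1 by ring, Nat.choose_succ_self_right, Ne,
        ZMod.natCast_eq_zero_iff]
      exact fun h => absurd (Nat.le_of_dvd (by omega) h) (by omega)
    rw [show 1 + (k + 1) = k + 2 by ring] at hc ⊢
    exact mul_ne_zero (mul_ne_zero hc hl) hh

/-- Weyl differencing: the square of an exponential sum is the sum over shifts `h` of the sums with
phase `P(t + h) - P(t)`. -/
theorem norm_sq_sum_stdAddChar {p : ℕ} [Fact p.Prime] (P : Polynomial (ZMod p)) :
    ‖∑ t, ZMod.stdAddChar (P.eval t)‖ ^ 2 ≤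
      ∑ h, ‖∑ t, ZMod.stdAddChar ((Polynomial.taylor h P - P).eval t)‖ := by
  have key : ((‖∑ t, ZMod.stdAddChar (P.eval t)‖ ^ 2 : ℝ) : ℂ) =
      ∑ h, ∑ t, ZMod.stdAddChar ((Polynomial.taylor h P - P).eval t) := by
    push_cast
    rw [← Complex.mul_conj', map_sum, Finset.sum_mul_sum, Finset.sum_comm]
    conv_rhs => rw [Finset.sum_comm]
    refine Finset.sum_congr rfl fun t _ => ?_
    rw [← Equiv.sum_comp (Equiv.addLeft t)]
    refine Finset.sum_congr rfl fun h _ => ?_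
    rw [← AddChar.map_neg_eq_conj, ← AddChar.map_add_eq_mul, Polynomial.eval_sub,
      Polynomial.taylor_eval, Equiv.coe_addLeft, sub_eq_add_neg]
  have h2 : ‖∑ t, ZMod.stdAddChar (P.eval t)‖ ^ 2 =
      ‖∑ h, ∑ t, ZMod.stdAddChar ((Polynomial.taylor h P - P).eval t)‖ := by
    rw [← key, Complex.norm_real, Real.norm_of_nonneg (by positivity)]
  rw [h2]
  exact norm_sum_le _ _

/-- Weyl's inequality over a prime field, by induction on the degree: in degree one the sum vanishes,
and each differencing step costs a square root of the saving. -/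
theorem norm_sum_stdAddChar_polynomial_le {p : ℕ} [Fact p.Prime] (k : ℕ) (hkp : k + 1 < p) :
    ∀ P : Polynomial (ZMod p), P.natDegree = k + 1 →
      ‖∑ t, ZMod.stdAddChar (P.eval t)‖ ≤ p * (2 * (p : ℝ) ^ (-(1 / 2 : ℝ) ^ (k + 1))) := by
  have hp0 : (0 : ℝ) < p := by exact_mod_cast (Fact.out : p.Prime).pos
  induction k with
  | zero =>
    intro P hP
    have hP' := Polynomial.eq_X_add_C_of_natDegree_le_one hP.le
    have h1 : P.coeff 1 ≠ 0 := by
      have : P ≠ 0 := by rintro rfl; simp at hP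
      have := Polynomial.leadingCoeff_ne_zero.2 this
      rwa [Polynomial.leadingCoeff, hP] at this
    have h0 : ∑ t, (ZMod.stdAddChar (P.eval t) : ℂ) = 0 := by
      rw [hP']
      simp only [Polynomial.eval_add, Polynomial.eval_mul, Polynomial.eval_C, Polynomial.eval_X,
        AddChar.map_add_eq_mul]
      rw [← Finset.sum_mul]
      simp_rw [mul_comm (P.coeff 1)]
      rw [AddChar.sum_mulShift _ (ZMod.isPrimitive_stdAddChar p), if_neg h1]
      simp
    rw [h0, norm_zero]
    positivity
  | succ k ih =>
    intro P hP
    set b : ℝ := (p : ℝ) ^ (-(1 / 2 : ℝ) ^ (k + 1)) with hb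
    set c : ℝ := (p : ℝ) ^ (-(1 / 2 : ℝ) ^ (k + 1 + 1)) with hc
    have hc0 : 0 < c := by positivity
    have hcb : c ^ 2 = b := by
      rw [hc, hb, ← Real.rpow_mul_natCast hp0.le]
      congr 1
      push_cast
      ring
    -- the diagonal shift `h = 0` contributes `p`, which is at most `p ^ 2 * b`
    have hpb : (p : ℝ) ≤ p ^ 2 * b := by
      have h1 : (1 : ℝ) ≤ p := by exact_mod_cast (Fact.out : p.Prime).one_le
      have : (p : ℝ) ^ (-1 : ℝ) ≤ b := by
        apply Real.rpow_le_rpow_of_exponent_le h1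
        have : (1 / 2 : ℝ) ^ (k + 1) ≤ 1 := pow_le_one₀ (by norm_num) (by norm_num)
        linarith
      rw [Real.rpow_neg_one] at this
      calc (p : ℝ) = p ^ 2 * (p : ℝ)⁻¹ := by field_simp
        _ ≤ _ := by gcongr
    have hsq : ‖∑ t, ZMod.stdAddChar (P.eval t)‖ ^ 2 ≤ (p * (2 * c)) ^ 2 := by
      refine (norm_sq_sum_stdAddChar P).trans ?_
      rw [← Finset.add_sum_erase _ _ (Finset.mem_univ (0 : ZMod p))]
      have h0 : ‖∑ t, (ZMod.stdAddChar ((Polynomial.taylor 0 P - P).eval t) : ℂ)‖ ≤ p := by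
        simp [ZMod.card]
      have h1 : ∑ h ∈ (Finset.univ : Finset (ZMod p)).erase 0,
          ‖∑ t, (ZMod.stdAddChar ((Polynomial.taylor h P - P).eval t) : ℂ)‖ ≤ p * (p * (2 * b)) := by
        refine (Finset.sum_le_card_nsmul _ _ (p * (2 * b)) fun h hh => ?_).trans ?_
        · exact ih (by omega) _ (natDegree_taylor_sub_self hP hkp (Finset.ne_of_mem_erase hh))
        · rw [nsmul_eq_mul]
          gcongr
          exact (Finset.card_le_univ _).trans (by simp [ZMod.card])
      calc _ ≤ (p : ℝ) + p * (p * (2 * b)) := add_le_add h0 h1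
        _ ≤ (p * (2 * c)) ^ 2 := by
          have : 0 < b := by positivity
          nlinarith [mul_pos (pow_pos hp0 2) this]
    exact le_of_sq_le_sq hsq (by positivity)

/-- A uniform form of Weyl's inequality: a polynomial of degree at most `D < p` that takes two
different values has an exponential sum saving `p ^ (-2 ^ (-D))`. -/
theorem norm_sum_stdAddChar_le_of_eval_ne {p : ℕ} [Fact p.Prime] {D : ℕ} (hD : D < p)
    (P : Polynomial (ZMod p)) (hP : P.natDegree ≤ D) {t₀ t₁ : ZMod p} (hne : P.eval t₀ ≠ P.eval t₁) :
    ‖∑ t, ZMod.stdAddChar (P.eval t)‖ ≤ p * (2 * (p : ℝ) ^ (-(1 / 2 : ℝ) ^ D)) := by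
  have h1 : (1 : ℝ) ≤ p := by exact_mod_cast (Fact.out : p.Prime).one_le
  obtain hk | ⟨k, hk⟩ : P.natDegree = 0 ∨ ∃ k, P.natDegree = k + 1 := by
    cases P.natDegree <;> simp
  · rw [Polynomial.eq_C_of_natDegree_eq_zero hk] at hne
    simp at hne
  · refine (norm_sum_stdAddChar_polynomial_le k (by omega) P hk).trans ?_
    gcongr _ * (2 * ?_)
    exact Real.rpow_le_rpow_of_exponent_le h1
      (neg_le_neg (pow_le_pow_of_le_one (by norm_num) (by norm_num) (by omega)))

/-! ### Polynomials along lines, zeros, and substitution -/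

/-- The restriction of a polynomial to the line `t ↦ x + t w`, as a polynomial in `t`. -/
theorem exists_polynomial_eval_line {K σ : Type*} [CommRing K] (F : MvPolynomial σ K) {D : ℕ}
    (hF : F.totalDegree ≤ D) (x w : σ → K) :
    ∃ P : Polynomial K, P.natDegree ≤ D ∧ ∀ t, P.eval t = MvPolynomial.eval (x + t • w) F := by
  refine ⟨MvPolynomial.aeval (fun i => Polynomial.C (w i) * Polynomial.X + Polynomial.C (x i)) F,
    ?_, fun t => ?_⟩
  · simpa using MvPolynomial.aeval_natDegree_le F hF _ fun i => Polynomial.natDegree_linear_le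
  · rw [MvPolynomial.aeval_def, MvPolynomial.eval₂_eq, MvPolynomial.eval_eq,
      Polynomial.eval_finsetSum]
    refine Finset.sum_congr rfl fun d _ => ?_
    simp [Polynomial.eval_prod, add_comm, mul_comm t]

/-- The Schwartz-Zippel bound for the number of zeros in the whole space `𝔽_p ^ n`. -/
theorem card_eval_eq_zero_mul_le {p : ℕ} [Fact p.Prime] {n D : ℕ}
    (F : MvPolynomial (Fin n) (ZMod p)) (hD : F.totalDegree ≤ D) (hF : F ≠ 0) :
    (Finset.univ.filter fun x => MvPolynomial.eval x F = 0).card * p ≤ D * p ^ n := by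
  have h := MvPolynomial.schwartz_zippel_totalDegree hF Finset.univ
  have hp : (0 : ℚ≥0) < p := by exact_mod_cast (Fact.out : p.Prime).pos
  simp only [Fintype.piFinset_univ, Finset.card_univ, ZMod.card] at h
  rw [div_le_div_iff₀ (by positivity) (by positivity)] at h
  have h' : (Finset.univ.filter fun x => MvPolynomial.eval x F = 0).card * p
      ≤ F.totalDegree * p ^ n := by exact_mod_cast h
  exact h'.trans (by gcongr)

/-- Substitution of fractions with a common denominator `T`, after clearing the denominator: the
polynomial `T ^ D * F (g / T)`. -/
theorem exists_mvPolynomial_eval_div {K σ τ : Type*} [Field K] [Fintype σ]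
    (F : MvPolynomial σ K) {D m : ℕ} (hF : F.totalDegree ≤ D) (T : MvPolynomial τ K)
    (g : σ → MvPolynomial τ K) (hT : T.totalDegree ≤ m) (hg : ∀ i, (g i).totalDegree ≤ m) :
    ∃ G : MvPolynomial τ K, G.totalDegree ≤ D * m ∧ ∀ x, MvPolynomial.eval x T ≠ 0 →
      MvPolynomial.eval x G = MvPolynomial.eval x T ^ D *
        MvPolynomial.eval (fun i => MvPolynomial.eval x (g i) / MvPolynomial.eval x T) F := by
  have hdeg : ∀ d ∈ F.support, ∑ i, d i ≤ D := fun d hd => by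
    have := MvPolynomial.le_totalDegree hd
    rw [Finsupp.sum_fintype _ _ (by simp)] at this
    omega
  refine ⟨∑ d ∈ F.support, MvPolynomial.C (F.coeff d) * (T ^ (D - ∑ i, d i) * ∏ i, g i ^ d i),
    ?_, fun x hx => ?_⟩
  · refine MvPolynomial.totalDegree_finsetSum_le fun d hd => ?_
    refine (MvPolynomial.totalDegree_mul _ _).trans ?_
    rw [MvPolynomial.totalDegree_C, zero_add]
    refine (MvPolynomial.totalDegree_mul _ _).trans ?_
    have h1 : (T ^ (D - ∑ i, d i)).totalDegree ≤ (D - ∑ i, d i) * m :=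
      (MvPolynomial.totalDegree_pow _ _).trans (by gcongr)
    have h2 : (∏ i, g i ^ d i).totalDegree ≤ (∑ i, d i) * m := by
      refine (MvPolynomial.totalDegree_finsetProd _ _).trans ?_
      rw [Finset.sum_mul]
      refine Finset.sum_le_sum fun i _ => (MvPolynomial.totalDegree_pow _ _).trans ?_
      gcongr
      exact hg i
    calc _ ≤ (D - ∑ i, d i) * m + (∑ i, d i) * m := add_le_add h1 h2
      _ = D * m := by rw [← add_mul, Nat.sub_add_cancel (hdeg d hd)]
  · rw [MvPolynomial.eval_eq' (f := F), Finset.mul_sum, map_sum]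
    refine Finset.sum_congr rfl fun d hd => ?_
    simp only [map_mul, MvPolynomial.eval_C, map_pow, map_prod, div_pow, Finset.prod_div_distrib]
    rw [Finset.prod_pow_eq_pow_sum]
    have : MvPolynomial.eval x T ^ D =
        MvPolynomial.eval x T ^ (D - ∑ i, d i) * MvPolynomial.eval x T ^ (∑ i, d i) := by
      rw [← pow_add, Nat.sub_add_cancel (hdeg d hd)]
    rw [this]
    field_simp

/-! ### Exponential sums over the quadric `c₀ c₁ = q(u)` -/

/-- The quadric `c₀ c₁ = q(c₂, …, c_{n+1})` in `𝔽_p ^ (n + 2)`. -/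
noncomputable def splitQuadric {p n : ℕ} [Fact p.Prime] (q : MvPolynomial (Fin n) (ZMod p)) :
    Finset (Fin (n + 2) → ZMod p) :=
  Finset.univ.filter fun c => c 0 * c 1 = MvPolynomial.eval (Fin.tail (Fin.tail c)) q

/-- The point of `splitQuadric q` with `c₀ = x₀ ≠ 0` and `u = (x₁, …, xₙ)`. -/
noncomputable def quadricPoint {p n : ℕ} [Fact p.Prime] (q : MvPolynomial (Fin n) (ZMod p))
    (x : Fin (n + 1) → ZMod p) : Fin (n + 2) → ZMod p :=
  Fin.cons (x 0) (Fin.cons (MvPolynomial.eval (Fin.tail x) q / x 0) (Fin.tail x))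

section

variable {p n : ℕ} [Fact p.Prime]

theorem mem_splitQuadric {q : MvPolynomial (Fin n) (ZMod p)} {c : Fin (n + 2) → ZMod p} :
    c ∈ splitQuadric q ↔ c 0 * c 1 = MvPolynomial.eval (Fin.tail (Fin.tail c)) q := by
  simp [splitQuadric]

theorem quadricPoint_mem (q : MvPolynomial (Fin n) (ZMod p)) {x : Fin (n + 1) → ZMod p}
    (hx : x 0 ≠ 0) : quadricPoint q x ∈ splitQuadric q := by
  rw [mem_splitQuadric]
  simp only [quadricPoint, Fin.cons_zero, Fin.tail_cons]
  rw [← Fin.succ_zero_eq_one, Fin.cons_succ, Fin.cons_zero, mul_div_cancel₀ _ hx]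

/-- The coordinates `(c₀, u)` of a point of the ambient space. -/
def dropSecond (c : Fin (n + 2) → ZMod p) : Fin (n + 1) → ZMod p :=
  Fin.cons (c 0) (Fin.tail (Fin.tail c))

theorem dropSecond_quadricPoint (q : MvPolynomial (Fin n) (ZMod p)) (x : Fin (n + 1) → ZMod p) :
    dropSecond (quadricPoint q x) = x := by
  simp [dropSecond, quadricPoint, Fin.cons_self_tail]

theorem quadricPoint_dropSecond {q : MvPolynomial (Fin n) (ZMod p)} {c : Fin (n + 2) → ZMod p}
    (hc : c ∈ splitQuadric q) (h0 : c 0 ≠ 0) : quadricPoint q (dropSecond c) = c := by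
  rw [mem_splitQuadric] at hc
  have h1 : c 1 = MvPolynomial.eval (Fin.tail (Fin.tail c)) q / c 0 := by
    rw [← hc, mul_div_cancel_left₀ _ h0]
  simp only [dropSecond, quadricPoint, Fin.tail_cons, Fin.cons_zero, ← h1]
  rw [show c 1 = Fin.tail c 0 from rfl, Fin.cons_self_tail, Fin.cons_self_tail]

/-- On the part `c₀ ≠ 0`, the quadric is the graph of `c₁ = q(u) / c₀`. -/
theorem sum_splitQuadric_ne_zero {M : Type*} [AddCommMonoid M]
    (q : MvPolynomial (Fin n) (ZMod p)) (Φ : (Fin (n + 2) → ZMod p) → M) :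
    ∑ c ∈ (splitQuadric q).filter (fun c => c 0 ≠ 0), Φ c =
      ∑ x ∈ Finset.univ.filter (fun x : Fin (n + 1) → ZMod p => x 0 ≠ 0),
        Φ (quadricPoint q x) := by
  refine Finset.sum_nbij' dropSecond (quadricPoint q) ?_ ?_ ?_ ?_ ?_
  · intro c hc
    simpa [dropSecond] using (Finset.mem_filter.1 hc).2
  · intro x hx
    have hx := (Finset.mem_filter.1 hx).2
    exact Finset.mem_filter.2 ⟨quadricPoint_mem q hx, by simpa [quadricPoint] using hx⟩
  · intro c hc
    exact quadricPoint_dropSecond (Finset.mem_filter.1 hc).1 (Finset.mem_filter.1 hc).2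
  · intro x _
    exact dropSecond_quadricPoint q x
  · intro c hc
    rw [quadricPoint_dropSecond (Finset.mem_filter.1 hc).1 (Finset.mem_filter.1 hc).2]

theorem card_splitQuadric_zero_le (q : MvPolynomial (Fin n) (ZMod p)) (hq : q.totalDegree ≤ 2)
    (hq0 : q ≠ 0) : ((splitQuadric q).filter (fun c => c 0 = 0)).card ≤ 2 * p ^ n := by
  have h1 : ((splitQuadric q).filter (fun c => c 0 = 0)).card ≤
      ((Finset.univ : Finset (ZMod p)) ×ˢ
        (Finset.univ.filter fun u => MvPolynomial.eval u q = 0)).card := by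
    refine Finset.card_le_card_of_injOn (fun c => (c 1, Fin.tail (Fin.tail c))) ?_ ?_
    · intro c hc
      obtain ⟨hc, h0⟩ := Finset.mem_filter.1 hc
      rw [mem_splitQuadric, h0, zero_mul] at hc
      simp [hc.symm]
    · intro c hc c' hc' h
      have h0 := (Finset.mem_filter.1 hc).2
      have h0' := (Finset.mem_filter.1 hc').2
      simp only [Prod.mk.injEq] at h
      rw [← Fin.cons_self_tail c, ← Fin.cons_self_tail c', ← Fin.cons_self_tail (Fin.tail c),
        ← Fin.cons_self_tail (Fin.tail c'), h0, h0', h.2]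
      exact congrArg _ (congrArg (fun y => (Fin.cons y _ : Fin (n + 1) → ZMod p)) h.1)
  rw [Finset.card_product, Finset.card_univ, ZMod.card, mul_comm] at h1
  exact h1.trans (card_eval_eq_zero_mul_le q hq hq0)

theorem card_filter_apply_zero_ne :
    (Finset.univ.filter (fun x : Fin (n + 1) → ZMod p => x 0 ≠ 0)).card = (p - 1) * p ^ n := by
  have : (Finset.univ.filter (fun x : Fin (n + 1) → ZMod p => x 0 ≠ 0)).card =
      (((Finset.univ : Finset (ZMod p)).erase 0) ×ˢ
        (Finset.univ : Finset (Fin n → ZMod p))).card := by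
    refine Finset.card_nbij' (fun x => (x 0, Fin.tail x)) (fun y => Fin.cons y.1 y.2) ?_ ?_ ?_ ?_
    · intro x hx; simpa using hx
    · intro x hx; simpa using hx
    · intro x _; simp
    · intro x _; simp
  rw [this, Finset.card_product, Finset.card_erase_of_mem (Finset.mem_univ _)]
  simp [ZMod.card]

theorem le_card_splitQuadric (q : MvPolynomial (Fin n) (ZMod p)) :
    (p - 1) * p ^ n ≤ (splitQuadric q).card := by
  have h := sum_splitQuadric_ne_zero q (fun _ => 1)
  rw [Finset.sum_const, Finset.sum_const, smul_eq_mul, smul_eq_mul, mul_one, mul_one,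
    card_filter_apply_zero_ne] at h
  rw [← h]
  exact Finset.card_le_card (Finset.filter_subset _ _)

/-- The polynomial `x₀ ^ D * f(x₀, q(u) / x₀, u)` that results from clearing denominators. -/
theorem exists_eval_quadricPoint (q : MvPolynomial (Fin n) (ZMod p)) (hq : q.totalDegree ≤ 2)
    (f : MvPolynomial (Fin (n + 2)) (ZMod p)) {D : ℕ} (hf : f.totalDegree ≤ D) :
    ∃ G : MvPolynomial (Fin (n + 1)) (ZMod p), G.totalDegree ≤ D * 2 ∧ ∀ x, x 0 ≠ 0 →
      MvPolynomial.eval x G = x 0 ^ D * MvPolynomial.eval (quadricPoint q x) f := by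
  obtain ⟨G, hG, h⟩ := exists_mvPolynomial_eval_div (m := 2) f hf
    (MvPolynomial.X (0 : Fin (n + 1)))
    (Fin.cons (MvPolynomial.X 0 * MvPolynomial.X 0) (Fin.cons (MvPolynomial.rename Fin.succ q)
      fun i => MvPolynomial.X 0 * MvPolynomial.X i.succ))
    (by simp)
    (by
      intro i
      refine Fin.cases ?_ (fun i => Fin.cases ?_ (fun i => ?_) i) i
      · rw [Fin.cons_zero]
        exact (MvPolynomial.totalDegree_mul _ _).trans (by simp)
      · rw [Fin.cons_succ, Fin.cons_zero]
        exact (MvPolynomial.totalDegree_rename_le _ _).trans hq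
      · rw [Fin.cons_succ, Fin.cons_succ]
        exact (MvPolynomial.totalDegree_mul _ _).trans (by simp))
  refine ⟨G, hG, fun x hx => ?_⟩
  rw [h x (by simpa using hx), MvPolynomial.eval_X]
  congr 2
  refine congrArg MvPolynomial.eval (funext fun i => ?_)
  refine Fin.cases ?_ (fun i => Fin.cases ?_ (fun i => ?_) i) i
  · simp [quadricPoint, hx]
  · simp [quadricPoint, MvPolynomial.eval_rename, Fin.tail_def, Function.comp_def]
  · simp [quadricPoint, hx, Fin.tail_def]

/-- If a polynomial function on the quadric is not determined by `c₀` on the part `c₀ ≠ 0`, then its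
exponential sum has a power saving. It is obtained by averaging over translates of a line
`(x₀, u + t w)` in the parameter space: Weyl's inequality applies on each line on which the function
is not constant, and by Schwartz-Zippel few lines are exceptional. -/
theorem norm_sum_splitQuadric_le (q : MvPolynomial (Fin n) (ZMod p)) (hq : q.totalDegree ≤ 2)
    (hq0 : q ≠ 0) (f : MvPolynomial (Fin (n + 2)) (ZMod p)) {D : ℕ} (hf : f.totalDegree ≤ D)
    (hD : D * 2 < p) {x y : Fin (n + 1) → ZMod p} (hx : x 0 ≠ 0) (hxy : x 0 = y 0)
    (hne : MvPolynomial.eval (quadricPoint q x) f ≠ MvPolynomial.eval (quadricPoint q y) f) :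
    ‖∑ c ∈ splitQuadric q, ZMod.stdAddChar (MvPolynomial.eval c f)‖ ≤
      (2 * D + 2) * p ^ n + p ^ (n + 1) * (2 * (p : ℝ) ^ (-(1 / 2 : ℝ) ^ (D * 2))) := by
  have hp0 : (0 : ℝ) < p := by exact_mod_cast (Fact.out : p.Prime).pos
  set ε : ℝ := 2 * (p : ℝ) ^ (-(1 / 2 : ℝ) ^ (D * 2)) with hε
  have hε0 : 0 ≤ ε := by positivity
  obtain ⟨G, hG, hGe⟩ := exists_eval_quadricPoint q hq f hf
  set w : Fin (n + 1) → ZMod p := y - x with hw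
  have hw0 : w 0 = 0 := by simp [hw, hxy]
  -- `H(x) = G(x + w) - G(x)` is nonzero, and where it does not vanish `G` is not constant on the
  -- line through `x` in direction `w`
  obtain ⟨G', hG', hGe'⟩ := exists_mvPolynomial_eval_div (m := 1) G hG 1
    (fun i => MvPolynomial.X i + MvPolynomial.C (w i)) (by simp)
    (fun i => (MvPolynomial.totalDegree_add _ _).trans (by simp))
  have hGe' : ∀ z, MvPolynomial.eval z G' = MvPolynomial.eval (z + w) G := fun z => by
    rw [hGe' z (by simp)]
    simp [Pi.add_def]
  set H := G' - G with hH
  have hHdeg : H.totalDegree ≤ D * 2 :=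
    (MvPolynomial.totalDegree_sub _ _).trans (max_le (by simpa using hG') hG)
  have hHe : ∀ z, MvPolynomial.eval z H =
      MvPolynomial.eval (z + w) G - MvPolynomial.eval z G := fun z => by
    rw [hH, map_sub, hGe']
  have hH0 : H ≠ 0 := by
    intro h0
    have := hHe x
    rw [h0, map_zero, hw, add_sub_cancel, hGe x hx, hGe y (hxy ▸ hx), ← hxy, ← mul_sub] at this
    exact hne (sub_eq_zero.1
      ((mul_eq_zero.1 this.symm).resolve_left (pow_ne_zero _ hx))).symm
  set A := Finset.univ.filter (fun x : Fin (n + 1) → ZMod p => x 0 ≠ 0) with hA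
  set Φ : (Fin (n + 1) → ZMod p) → ℂ :=
    fun z => ZMod.stdAddChar (MvPolynomial.eval (quadricPoint q z) f) with hΦ
  have hline : ∀ z ∈ A, MvPolynomial.eval z H ≠ 0 → ‖∑ t : ZMod p, Φ (z + t • w)‖ ≤ p * ε := by
    intro z hz hzH
    have hz : z 0 ≠ 0 := (Finset.mem_filter.1 hz).2
    obtain ⟨P, hP, hPe⟩ := exists_polynomial_eval_line G hG z w
    have key : ∀ t, (Polynomial.C ((z 0 ^ D)⁻¹) * P).eval t =
        MvPolynomial.eval (quadricPoint q (z + t • w)) f := fun t => by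
      have h0 : (z + t • w) 0 = z 0 := by simp [hw0]
      rw [Polynomial.eval_mul, Polynomial.eval_C, hPe, hGe _ (by rwa [h0]), h0,
        inv_mul_cancel_left₀ (pow_ne_zero _ hz)]
    have hb := norm_sum_stdAddChar_le_of_eval_ne (t₀ := 1) (t₁ := 0) hD
      (Polynomial.C ((z 0 ^ D)⁻¹) * P) ((Polynomial.natDegree_C_mul_le _ _).trans hP) (by
        rw [Polynomial.eval_mul, Polynomial.eval_mul, Polynomial.eval_C, Polynomial.eval_C,
          hPe, hPe]
        intro h
        apply hzH
        rw [hHe, sub_eq_zero]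
        simpa using mul_left_cancel₀ (inv_ne_zero (pow_ne_zero _ hz)) h)
    simpa only [key] using hb
  have hΦ1 : ∀ z, ‖Φ z‖ = 1 := fun z => AddChar.norm_apply _ _
  have hlines : ‖∑ z ∈ A, ∑ t : ZMod p, Φ (z + t • w)‖ ≤
      p * (2 * D * p ^ n) + p ^ (n + 1) * (p * ε) := by
    refine (norm_sum_le _ _).trans ?_
    rw [← Finset.sum_filter_add_sum_filter_not A (fun z => MvPolynomial.eval z H = 0)]
    refine add_le_add ?_ ?_
    · refine (Finset.sum_le_card_nsmul _ _ (p : ℝ) fun z _ => ?_).trans ?_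
      · refine (norm_sum_le _ _).trans ?_
        simp [hΦ1, ZMod.card]
      · have h1 := card_eval_eq_zero_mul_le H hHdeg hH0
        have h2 : (A.filter fun z => MvPolynomial.eval z H = 0).card ≤ D * 2 * p ^ n := by
          refine (Finset.card_le_card (Finset.filter_subset_filter _ (Finset.subset_univ A))).trans ?_
          refine Nat.le_of_mul_le_mul_right (h1.trans (le_of_eq ?_)) (Fact.out : p.Prime).pos
          ring
        rw [nsmul_eq_mul, mul_comm]
        gcongr
        calc _ ≤ ((D * 2 * p ^ n : ℕ) : ℝ) := by exact_mod_cast h2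
          _ = _ := by push_cast; ring
    · refine (Finset.sum_le_card_nsmul _ _ (p * ε) fun z hz => ?_).trans ?_
      · exact hline z (Finset.mem_filter.1 hz).1 (Finset.mem_filter.1 hz).2
      · rw [nsmul_eq_mul]
        gcongr
        refine (Nat.cast_le.2 (Finset.card_le_univ _)).trans ?_
        simp [ZMod.card]
  have hshift : ∑ z ∈ A, ∑ t : ZMod p, Φ (z + t • w) = p * ∑ z ∈ A, Φ z := by
    rw [Finset.sum_comm]
    have : ∀ t : ZMod p, ∑ z ∈ A, Φ (z + t • w) = ∑ z ∈ A, Φ z := fun t => by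
      refine Finset.sum_equiv (Equiv.addRight (t • w)) (fun z => ?_) fun z _ => rfl
      simp [hA, hw0]
    simp [this, ZMod.card]
  have hmain : ‖∑ z ∈ A, Φ z‖ ≤ 2 * D * p ^ n + p ^ (n + 1) * ε := by
    rw [hshift, norm_mul, Complex.norm_natCast] at hlines
    refine le_of_mul_le_mul_left (hlines.trans (le_of_eq ?_)) hp0
    ring
  have hsmall : ‖∑ c ∈ (splitQuadric q).filter (fun c => c 0 = 0),
      (ZMod.stdAddChar (MvPolynomial.eval c f) : ℂ)‖ ≤ 2 * p ^ n := by
    refine (norm_sum_le _ _).trans ?_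
    simp only [AddChar.norm_apply, Finset.sum_const, nsmul_eq_mul, mul_one]
    exact_mod_cast card_splitQuadric_zero_le q hq hq0
  rw [← Finset.sum_filter_add_sum_filter_not (splitQuadric q) (fun c => c 0 = 0),
    sum_splitQuadric_ne_zero q fun c => (ZMod.stdAddChar (MvPolynomial.eval c f) : ℂ)]
  refine (norm_add_le _ _).trans ((add_le_add hsmall hmain).trans (le_of_eq ?_))
  ring

end

section

variable {p n : ℕ} [Fact p.Prime]

theorem comp_swap_mem_splitQuadric {q : MvPolynomial (Fin n) (ZMod p)} {c : Fin (n + 2) → ZMod p} :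
    c ∘ Equiv.swap 0 1 ∈ splitQuadric q ↔ c ∈ splitQuadric q := by
  have h : Fin.tail (Fin.tail (c ∘ Equiv.swap 0 1)) = Fin.tail (Fin.tail c) := by
    funext i
    simp only [Fin.tail_def, Function.comp_apply]
    have h1 : i.succ.succ ≠ 1 := fun h => Fin.succ_ne_zero i (Fin.succ_injective _ h)
    rw [Equiv.swap_apply_of_ne_of_ne (Fin.succ_ne_zero _) h1]
  rw [mem_splitQuadric, mem_splitQuadric, h]
  simp [mul_comm]

/-- If `f` depends only on `c₀` where `c₀ ≠ 0` and only on `c₁` where `c₁ ≠ 0`, then it is constant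
on the quadric, provided that `q` takes every value. -/
theorem eval_eq_of_splitQuadric (q : MvPolynomial (Fin n) (ZMod p))
    (hsurj : ∀ b, ∃ u, MvPolynomial.eval u q = b)
    (f : MvPolynomial (Fin (n + 2)) (ZMod p)) {D : ℕ} (hf : f.totalDegree ≤ D) (hD : D + 1 < p)
    (h0 : ∀ c ∈ splitQuadric q, ∀ c' ∈ splitQuadric q, c 0 ≠ 0 → c 0 = c' 0 →
      MvPolynomial.eval c f = MvPolynomial.eval c' f)
    (h1 : ∀ c ∈ splitQuadric q, ∀ c' ∈ splitQuadric q, c 1 ≠ 0 → c 1 = c' 1 →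
      MvPolynomial.eval c f = MvPolynomial.eval c' f) :
    ∃ b, ∀ c ∈ splitQuadric q, MvPolynomial.eval c f = b := by
  have hmk : ∀ a b : ZMod p, ∃ c ∈ splitQuadric q, c 0 = a ∧ c 1 = b := fun a b => by
    obtain ⟨u, hu⟩ := hsurj (a * b)
    refine ⟨Fin.cons a (Fin.cons b u), ?_, rfl, rfl⟩
    rw [mem_splitQuadric, Fin.tail_cons, Fin.tail_cons, hu]
    rfl
  obtain ⟨e, he, he0, he1⟩ := hmk 1 1
  -- a point with `c₀ ≠ 0` is joined to `e` through a point with coordinates `(c₀, 1)`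
  have hc0 : ∀ c ∈ splitQuadric q, c 0 ≠ 0 → MvPolynomial.eval c f = MvPolynomial.eval e f := by
    intro c hc hc0
    obtain ⟨c', hc', h0', h1'⟩ := hmk (c 0) 1
    rw [h0 c hc c' hc' hc0 h0'.symm, h1 c' hc' e he (by simp [h1']) (h1'.trans he1.symm)]
  refine ⟨MvPolynomial.eval e f, fun c hc => ?_⟩
  by_cases hc1 : c 1 = 0
  · -- `c = (c₀, 0, u)` lies on the line `(t, 0, u)` in the quadric; along it `f` is a polynomial in
    -- `t` that is constant for `t ≠ 0`, hence constant
    obtain ⟨P, hP, hPe⟩ := exists_polynomial_eval_line f hf (Function.update c 0 0) (Pi.single 0 1)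
    have hpt : ∀ t : ZMod p, Function.update c 0 0 + t • Pi.single 0 1 = Function.update c 0 t := by
      intro t
      funext i
      by_cases hi : i = 0
      · subst hi; simp
      · simp [hi]
    have hmem : ∀ t : ZMod p, Function.update c 0 t ∈ splitQuadric q := by
      intro t
      rw [mem_splitQuadric] at hc ⊢
      have : Fin.tail (Fin.tail (Function.update c 0 t)) = Fin.tail (Fin.tail c) := by
        funext i
        simp [Fin.tail_def]
      rw [this, ← hc]
      simp [hc1]
    have hPc : P = Polynomial.C (MvPolynomial.eval e f) := by
      rw [← sub_eq_zero]
      refine Polynomial.eq_zero_of_natDegree_lt_card_of_eval_eq_zero' _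
        (Finset.univ.erase (0 : ZMod p)) (fun t ht => ?_) ?_
      · rw [Polynomial.eval_sub, Polynomial.eval_C, hPe, hpt,
          hc0 _ (hmem t) (by simpa using ht), sub_self]
      · rw [Polynomial.natDegree_sub_C, Finset.card_erase_of_mem (Finset.mem_univ _),
          Finset.card_univ, ZMod.card]
        omega
    have := hPe (c 0)
    rw [hpt, Function.update_eq_self, hPc, Polynomial.eval_C] at this
    exact this.symm
  · obtain ⟨c', hc', h0', h1'⟩ := hmk 1 (c 1)
    rw [h1 c hc c' hc' hc1 h1'.symm, hc0 c' hc' (by simp [h0'])]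

/-- A polynomial function on the quadric is constant, or its exponential sum has a power saving. -/
theorem splitQuadric_dichotomy (q : MvPolynomial (Fin n) (ZMod p)) (hq : q.totalDegree ≤ 2)
    (hsurj : ∀ b, ∃ u, MvPolynomial.eval u q = b)
    (f : MvPolynomial (Fin (n + 2)) (ZMod p)) {D : ℕ} (hf : f.totalDegree ≤ D)
    (hD : D * 2 + 1 < p) :
    ‖∑ c ∈ splitQuadric q, ZMod.stdAddChar (MvPolynomial.eval c f)‖ ≤
        (2 * D + 2) * p ^ n + p ^ (n + 1) * (2 * (p : ℝ) ^ (-(1 / 2 : ℝ) ^ (D * 2))) ∨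
      ∃ b, ∀ c ∈ splitQuadric q, MvPolynomial.eval c f = b := by
  have hq0 : q ≠ 0 := by
    rintro rfl
    obtain ⟨u, hu⟩ := hsurj 1
    simp at hu
  refine or_iff_not_imp_left.2 fun hlt => ?_
  have key : ∀ f' : MvPolynomial (Fin (n + 2)) (ZMod p), f'.totalDegree ≤ D →
      ∑ c ∈ splitQuadric q, (ZMod.stdAddChar (MvPolynomial.eval c f') : ℂ) =
        ∑ c ∈ splitQuadric q, ZMod.stdAddChar (MvPolynomial.eval c f) →
      ∀ c ∈ splitQuadric q, ∀ c' ∈ splitQuadric q, c 0 ≠ 0 → c 0 = c' 0 →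
      MvPolynomial.eval c f' = MvPolynomial.eval c' f' := by
    intro f' hf' hsum c hc c' hc' hc0 h
    by_contra hne
    refine hlt (hsum ▸ norm_sum_splitQuadric_le q hq hq0 f' hf' (by omega)
      (x := dropSecond c) (y := dropSecond c') hc0 h ?_)
    rwa [quadricPoint_dropSecond hc hc0, quadricPoint_dropSecond hc' (h ▸ hc0)]
  refine eval_eq_of_splitQuadric q hsurj f hf (by omega) (key f hf rfl) ?_
  intro c hc c' hc' hc1 h
  have hsw : ∀ c : Fin (n + 2) → ZMod p, (c ∘ Equiv.swap 0 1) ∘ Equiv.swap 0 1 = c := fun c => by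
    funext i; simp
  have := key (MvPolynomial.rename (Equiv.swap 0 1) f)
    ((MvPolynomial.totalDegree_rename_le _ _).trans hf) (by
      simp only [MvPolynomial.eval_rename]
      exact Finset.sum_nbij' (· ∘ Equiv.swap 0 1) (· ∘ Equiv.swap 0 1)
        (fun c hc => comp_swap_mem_splitQuadric.2 hc) (fun c hc => comp_swap_mem_splitQuadric.2 hc)
        (fun c _ => hsw c) (fun c _ => hsw c) fun c _ => rfl)
    (c ∘ Equiv.swap 0 1) (comp_swap_mem_splitQuadric.2 hc)
    (c' ∘ Equiv.swap 0 1) (comp_swap_mem_splitQuadric.2 hc') (by simpa using hc1) (by simpa using h)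
  rwa [MvPolynomial.eval_rename, MvPolynomial.eval_rename, hsw, hsw] at this

end

/-! ### Splitting the sphere -/

section

variable {p m : ℕ} [Fact p.Prime]

/-- The linear change of coordinates `c ↦ c₀ (1, α, β) + c₁ (1, -α, -β) + c₂ (0, -β, α) + ⋯`. When
`α ^ 2 + β ^ 2 = -1` the first two vectors are isotropic, and the third is orthogonal to them. -/
def hyperbolicCoords (α β : ZMod p) (c : Fin (m + 3) → ZMod p) : Fin (m + 3) → ZMod p :=
  Fin.cons (c 0 + c 1) (Fin.cons (α * (c 0 - c 1) - β * c 2) (Fin.cons (β * (c 0 - c 1) + α * c 2)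
    fun i => c i.succ.succ.succ))

/-- The inverse of `hyperbolicCoords`. -/
def hyperbolicCoordsInv (α β : ZMod p) (x : Fin (m + 3) → ZMod p) : Fin (m + 3) → ZMod p :=
  Fin.cons ((x 0 - (α * x 1 + β * x 2)) / 2) (Fin.cons ((x 0 + (α * x 1 + β * x 2)) / 2)
    (Fin.cons (β * x 1 - α * x 2) fun i => x i.succ.succ.succ))

/-- The coordinates of `hyperbolicCoords`, as polynomials. -/
noncomputable def hyperbolicCoordsPoly (α β : ZMod p) :
    Fin (m + 3) → MvPolynomial (Fin (m + 3)) (ZMod p) :=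
  open MvPolynomial in
  Fin.cons (X 0 + X 1) (Fin.cons (C α * (X 0 - X 1) - C β * X 2)
    (Fin.cons (C β * (X 0 - X 1) + C α * X 2) fun i => X i.succ.succ.succ))

theorem eval_hyperbolicCoordsPoly (α β : ZMod p) (c : Fin (m + 3) → ZMod p) (i : Fin (m + 3)) :
    MvPolynomial.eval c (hyperbolicCoordsPoly α β i) = hyperbolicCoords α β c i := by
  refine Fin.cases ?_ (fun i => Fin.cases ?_ (fun i => Fin.cases ?_ (fun i => ?_) i) i) i <;>
  · simp only [hyperbolicCoordsPoly, hyperbolicCoords, Fin.cons_zero, Fin.cons_succ]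
    simp

theorem totalDegree_hyperbolicCoordsPoly_le (α β : ZMod p) (i : Fin (m + 3)) :
    (hyperbolicCoordsPoly α β i).totalDegree ≤ 1 := by
  have hX : ∀ i : Fin (m + 3), (MvPolynomial.X i : MvPolynomial _ (ZMod p)).totalDegree ≤ 1 :=
    fun i => (MvPolynomial.totalDegree_X i).le
  have hC : ∀ (a : ZMod p) (P : MvPolynomial (Fin (m + 3)) (ZMod p)), P.totalDegree ≤ 1 →
      (MvPolynomial.C a * P).totalDegree ≤ 1 := fun a P hP =>
    (MvPolynomial.totalDegree_mul _ _).trans (by simpa using hP)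
  have hsub : (MvPolynomial.X 0 - MvPolynomial.X 1 :
      MvPolynomial (Fin (m + 3)) (ZMod p)).totalDegree ≤ 1 :=
    (MvPolynomial.totalDegree_sub _ _).trans (max_le (hX 0) (hX 1))
  refine Fin.cases ?_ (fun i => Fin.cases ?_ (fun i => Fin.cases ?_ (fun i => ?_) i) i) i
  · exact (MvPolynomial.totalDegree_add _ _).trans (max_le (hX 0) (hX 1))
  · exact (MvPolynomial.totalDegree_sub _ _).trans (max_le (hC _ _ hsub) (hC _ _ (hX 2)))
  · exact (MvPolynomial.totalDegree_add _ _).trans (max_le (hC _ _ hsub) (hC _ _ (hX 2)))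
  · exact hX _

/-- The quadratic polynomial `(r + u₀ ^ 2 - u₁ ^ 2 - ⋯ - u_m ^ 2) / 4`. -/
noncomputable def sphereQuadratic (r : ZMod p) : MvPolynomial (Fin (m + 1)) (ZMod p) :=
  MvPolynomial.C (1 / 4) * (MvPolynomial.C r + MvPolynomial.X 0 ^ 2 -
    ∑ i : Fin m, MvPolynomial.X i.succ ^ 2)

theorem totalDegree_sphereQuadratic_le (r : ZMod p) :
    (sphereQuadratic r : MvPolynomial (Fin (m + 1)) (ZMod p)).totalDegree ≤ 2 := by
  refine (MvPolynomial.totalDegree_mul _ _).trans ?_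
  rw [MvPolynomial.totalDegree_C, zero_add]
  refine (MvPolynomial.totalDegree_sub _ _).trans (max_le ?_ ?_)
  · exact (MvPolynomial.totalDegree_add _ _).trans (by simp)
  · exact MvPolynomial.totalDegree_finsetSum_le fun i _ => by simp

theorem eval_sphereQuadratic (r : ZMod p) (u : Fin (m + 1) → ZMod p) :
    MvPolynomial.eval u (sphereQuadratic r) = 1 / 4 * (r + u 0 ^ 2 - ∑ i : Fin m, u i.succ ^ 2) := by
  simp [sphereQuadratic]

theorem exists_eval_sphereQuadratic_eq (hp : p ≠ 2) (hm : 0 < m) (r b : ZMod p) :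
    ∃ u : Fin (m + 1) → ZMod p, MvPolynomial.eval u (sphereQuadratic r) = b := by
  obtain ⟨m, rfl⟩ := Nat.exists_eq_succ_of_ne_zero hm.ne'
  have h2 : (2 : ZMod p) ≠ 0 := Ring.two_ne_zero (by rwa [ZMod.ringChar_zmod_n])
  have h4 : (4 : ZMod p) ≠ 0 := by
    rw [show (4 : ZMod p) = 2 * 2 by norm_num]; exact mul_ne_zero h2 h2
  -- solve `(u₀ - u₁) (u₀ + u₁) = 4 b - r` with `u₀ - u₁ = 1`
  refine ⟨Fin.cons ((4 * b - r + 1) / 2) (Fin.cons ((4 * b - r - 1) / 2) 0), ?_⟩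
  rw [eval_sphereQuadratic, Fin.sum_univ_succ]
  simp only [Fin.cons_zero, Fin.cons_succ, Pi.zero_apply]
  simp
  field_simp
  ring

theorem dotProduct_hyperbolicCoords (hp : p ≠ 2) {α β : ZMod p} (hαβ : α ^ 2 + β ^ 2 = -1)
    (r : ZMod p) (c : Fin (m + 3) → ZMod p) :
    hyperbolicCoords α β c ⬝ᵥ hyperbolicCoords α β c = r ↔
      c ∈ splitQuadric (sphereQuadratic (m := m) r) := by
  have h2 : (2 : ZMod p) ≠ 0 := Ring.two_ne_zero (by rwa [ZMod.ringChar_zmod_n])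
  have h4 : (4 : ZMod p) ≠ 0 := by
    rw [show (4 : ZMod p) = 2 * 2 by norm_num]; exact mul_ne_zero h2 h2
  have h : hyperbolicCoords α β c ⬝ᵥ hyperbolicCoords α β c =
      4 * (c 0 * c 1) - c 2 ^ 2 + ∑ i : Fin m, c i.succ.succ.succ ^ 2 := by
    simp only [dotProduct, hyperbolicCoords, Fin.sum_univ_succ, Fin.cons_zero, Fin.cons_succ]
    simp only [← pow_two]
    linear_combination ((c 0 - c 1) ^ 2 + c 2 ^ 2) * hαβ
  have hu : Fin.tail (Fin.tail c) 0 = c 2 := rfl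
  have hu' : ∀ i : Fin m, Fin.tail (Fin.tail c) i.succ = c i.succ.succ.succ := fun i => rfl
  rw [h, mem_splitQuadric, eval_sphereQuadratic, hu]
  simp only [hu']
  constructor
  · intro h
    rw [← h]
    field_simp
    ring
  · intro h
    rw [h]
    field_simp
    ring

theorem hyperbolicCoordsInv_hyperbolicCoords (hp : p ≠ 2) {α β : ZMod p}
    (hαβ : α ^ 2 + β ^ 2 = -1) (c : Fin (m + 3) → ZMod p) :
    hyperbolicCoordsInv α β (hyperbolicCoords α β c) = c := by
  have h2 : (2 : ZMod p) ≠ 0 := Ring.two_ne_zero (by rwa [ZMod.ringChar_zmod_n])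
  funext i
  refine Fin.cases ?_ (fun i => Fin.cases ?_ (fun i => Fin.cases ?_ (fun i => ?_) i) i) i
  · change (c 0 + c 1 - (α * (α * (c 0 - c 1) - β * c 2) + β * (β * (c 0 - c 1) + α * c 2))) / 2 =
      c 0
    field_simp
    linear_combination -(c 0 - c 1) * hαβ
  · change (c 0 + c 1 + (α * (α * (c 0 - c 1) - β * c 2) + β * (β * (c 0 - c 1) + α * c 2))) / 2 =
      c 1
    field_simp
    linear_combination (c 0 - c 1) * hαβ
  · change β * (α * (c 0 - c 1) - β * c 2) - α * (β * (c 0 - c 1) + α * c 2) = c 2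
    linear_combination -c 2 * hαβ
  · rfl

theorem hyperbolicCoords_hyperbolicCoordsInv (hp : p ≠ 2) {α β : ZMod p}
    (hαβ : α ^ 2 + β ^ 2 = -1) (x : Fin (m + 3) → ZMod p) :
    hyperbolicCoords α β (hyperbolicCoordsInv α β x) = x := by
  have hinj : Function.LeftInverse (hyperbolicCoordsInv α β) (hyperbolicCoords (m := m) α β) :=
    hyperbolicCoordsInv_hyperbolicCoords hp hαβ
  obtain ⟨c, rfl⟩ := Finite.surjective_of_injective hinj.injective x
  rw [hinj c]

/-- A polynomial function on the sphere is constant, or its exponential sum has a power saving. -/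
theorem sphere_dichotomy (hm : 0 < m) (r : ZMod p) (f : MvPolynomial (Fin (m + 3)) (ZMod p))
    {D : ℕ} (hf : f.totalDegree ≤ D) (hp : p ≠ 2) (hD : D * 2 + 1 < p) :
    (p - 1) * p ^ (m + 1) ≤ (sphere p (m + 3) r).card ∧
      (‖∑ x ∈ sphere p (m + 3) r, ZMod.stdAddChar (MvPolynomial.eval x f)‖ ≤
          (2 * D + 2) * p ^ (m + 1) +
            p ^ (m + 2) * (2 * (p : ℝ) ^ (-(1 / 2 : ℝ) ^ (D * 2))) ∨
        ∃ b, ∀ x ∈ sphere p (m + 3) r, MvPolynomial.eval x f = b) := by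
  obtain ⟨α, β, hαβ⟩ := ZMod.sq_add_sq p (-1)
  have hl := hyperbolicCoordsInv_hyperbolicCoords (m := m) hp hαβ
  have hr := hyperbolicCoords_hyperbolicCoordsInv (m := m) hp hαβ
  have hmem : ∀ c, hyperbolicCoords α β c ∈ sphere p (m + 3) r ↔
      c ∈ splitQuadric (sphereQuadratic (m := m) r) := fun c => by
    rw [← dotProduct_hyperbolicCoords hp hαβ]
    simp [sphere]
  have hmem' : ∀ x, x ∈ sphere p (m + 3) r ↔
      hyperbolicCoordsInv α β x ∈ splitQuadric (sphereQuadratic (m := m) r) := fun x => by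
    rw [← hmem, hr]
  obtain ⟨f', hf', hfe⟩ := exists_mvPolynomial_eval_div (m := 1) f hf 1
    (hyperbolicCoordsPoly α β) (by simp) (totalDegree_hyperbolicCoordsPoly_le α β)
  have hfe : ∀ c, MvPolynomial.eval c f' = MvPolynomial.eval (hyperbolicCoords α β c) f :=
    fun c => by
      rw [hfe c (by simp)]
      simp [eval_hyperbolicCoordsPoly]
  refine ⟨?_, ?_⟩
  · refine (le_card_splitQuadric (sphereQuadratic (m := m) r)).trans (le_of_eq ?_)
    exact Finset.card_nbij' (hyperbolicCoords α β) (hyperbolicCoordsInv α β)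
      (fun c hc => (hmem c).2 hc) (fun x hx => (hmem' x).1 hx) (fun c _ => hl c) fun x _ => hr x
  · refine (splitQuadric_dichotomy (sphereQuadratic (m := m) r) (totalDegree_sphereQuadratic_le r)
      (exists_eval_sphereQuadratic_eq hp hm r) f' (by simpa using hf') hD).imp ?_ ?_
    · refine fun h => le_trans (le_of_eq (congrArg _ ?_)) h
      exact (Finset.sum_nbij' (hyperbolicCoords α β) (hyperbolicCoordsInv α β)
        (fun c hc => (hmem c).2 hc) (fun x hx => (hmem' x).1 hx) (fun c _ => hl c)
        (fun x _ => hr x) fun c _ => by rw [hfe]).symm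
    · rintro ⟨b, hb⟩
      refine ⟨b, fun x hx => ?_⟩
      rw [← hb _ ((hmem' x).1 hx), hfe, hr]

end

/-! ### Integer-valued polynomials modulo `p` -/

/-- The product of `k - j` over the nodes `j ≠ k` in `{0, …, s}`. -/
def nodeProd (s k : ℕ) : ℤ := ∏ j ∈ (Finset.range (s + 1)).erase k, ((k : ℤ) - j)

theorem not_dvd_nodeProd {p : ℕ} [Fact p.Prime] {s k : ℕ} (hs : s < p) (hk : k ≤ s) :
    ¬ (p : ℤ) ∣ nodeProd s k := by
  rw [nodeProd, Prime.dvd_finsetProd_iff (Nat.prime_iff_prime_int.1 Fact.out)]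
  rintro ⟨j, hj, hd⟩
  rw [Finset.mem_erase, Finset.mem_range] at hj
  have := Int.eq_zero_of_abs_lt_dvd hd (by rw [abs_lt]; omega)
  omega

/-- The product `∏ᵢ ∏_{j ≠ κᵢ} (Xᵢ - j)` over the nodes `j` in `{0, …, s}`, which vanishes at all
points of the grid `{0, …, s} ^ d` but `κ`. -/
noncomputable def nodePoly {d : ℕ} (s : ℕ) (κ : Fin d → ℕ) : MvPolynomial (Fin d) ℤ :=
  ∏ i, ∏ j ∈ (Finset.range (s + 1)).erase (κ i), (MvPolynomial.X i - MvPolynomial.C (j : ℤ))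

theorem eval_nodePoly {d s : ℕ} (κ : Fin d → ℕ) (x : Fin d → ℤ) :
    MvPolynomial.eval x (nodePoly s κ) =
      ∏ i, ∏ j ∈ (Finset.range (s + 1)).erase (κ i), (x i - j) := by
  simp [nodePoly]

theorem degreeOf_nodePoly_le {d s : ℕ} {κ : Fin d → ℕ} (hκ : ∀ i, κ i ∈ Finset.range (s + 1))
    (i : Fin d) : (nodePoly s κ).degreeOf i ≤ s := by
  refine (MvPolynomial.degreeOf_prod_le _ _ _).trans ?_
  have h : ∀ l, (∏ j ∈ (Finset.range (s + 1)).erase (κ l),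
      (MvPolynomial.X l - MvPolynomial.C (j : ℤ))).degreeOf i ≤ if i = l then s else 0 := by
    intro l
    refine (MvPolynomial.degreeOf_prod_le _ _ _).trans ?_
    refine (Finset.sum_le_card_nsmul _ _ (if i = l then 1 else 0) fun j _ => ?_).trans ?_
    · refine (MvPolynomial.degreeOf_sub_le _ _ _).trans ?_
      rw [MvPolynomial.degreeOf_C, MvPolynomial.degreeOf_X, max_eq_left (Nat.zero_le _)]
    · rw [Finset.card_erase_of_mem (hκ l)]; split_ifs <;> simp
  exact (Finset.sum_le_sum fun l _ => h l).trans (by simp)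

theorem totalDegree_nodePoly_le {d s : ℕ} {κ : Fin d → ℕ} (hκ : ∀ i, κ i ∈ Finset.range (s + 1)) :
    (nodePoly s κ).totalDegree ≤ d * s := by
  refine (MvPolynomial.totalDegree_finsetProd _ _).trans ?_
  refine (Finset.sum_le_card_nsmul _ _ s fun i _ => ?_).trans (by simp)
  refine (MvPolynomial.totalDegree_finsetProd _ _).trans ?_
  refine (Finset.sum_le_card_nsmul _ _ 1 fun j _ => ?_).trans ?_
  · exact (MvPolynomial.totalDegree_sub_C_le _ _).trans (MvPolynomial.totalDegree_X _).le
  · rw [Finset.card_erase_of_mem (hκ i)]; simp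

/-- An integer-valued polynomial of degree at most `s < p` is, modulo `p`, given by a polynomial
over `𝔽_p`. Indeed, Lagrange interpolation on the grid `{0, …, s} ^ d` shows that its coefficients
have denominators prime to `p`. -/
theorem IsIntValuedPoly.exists_mvPolynomial_zmod {p d s : ℕ} [Fact p.Prime] (hs : s < p)
    {g : (Fin d → ℤ) → ℤ} (hg : IsIntValuedPoly s g) :
    ∃ f : MvPolynomial (Fin d) (ZMod p), f.totalDegree ≤ d * s ∧
      ∀ n : Fin d → ℤ, MvPolynomial.eval (fun i => (n i : ZMod p)) f = (g n : ZMod p) := by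
  obtain ⟨P, hP, hPg⟩ := hg
  set grid : Finset (Fin d → ℕ) := Fintype.piFinset fun _ => Finset.range (s + 1) with hgrid
  set W : (Fin d → ℕ) → ℤ := fun κ => ∏ i, nodeProd s (κ i) with hW
  set M : ℤ := ∏ κ ∈ grid, W κ with hM
  have hMp : (M : ZMod p) ≠ 0 := by
    rw [Ne, ZMod.intCast_zmod_eq_zero_iff_dvd, hM,
      Prime.dvd_finsetProd_iff (Nat.prime_iff_prime_int.1 Fact.out)]
    rintro ⟨κ, hκ, hd⟩
    obtain ⟨i, _, hd⟩ := (Prime.dvd_finsetProd_iff (Nat.prime_iff_prime_int.1 Fact.out) _).1 hd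
    have := Fintype.mem_piFinset.1 hκ i
    exact not_dvd_nodeProd hs (Finset.mem_range_succ_iff.1 this) hd
  -- the interpolation polynomial of `g`, multiplied by the common denominator `M`
  set Q : MvPolynomial (Fin d) ℤ := ∑ κ ∈ grid,
    MvPolynomial.C ((∏ κ' ∈ grid.erase κ, W κ') * g fun i => κ i) * nodePoly s κ with hQ
  have hQdeg : Q.totalDegree ≤ d * s := by
    refine MvPolynomial.totalDegree_finsetSum_le fun κ hκ => ?_
    refine (MvPolynomial.totalDegree_mul _ _).trans ?_
    rw [MvPolynomial.totalDegree_C, zero_add]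
    exact totalDegree_nodePoly_le (Fintype.mem_piFinset.1 hκ)
  have hQdegOf : ∀ i, Q.degreeOf i ≤ s := fun i => by
    refine (MvPolynomial.degreeOf_sum_le _ _ _).trans (Finset.sup_le fun κ hκ => ?_)
    exact (MvPolynomial.degreeOf_C_mul_le _ _ _).trans
      (degreeOf_nodePoly_le (Fintype.mem_piFinset.1 hκ) i)
  have hQgrid : ∀ κ ∈ grid, MvPolynomial.eval (fun i => (κ i : ℤ)) Q = M * g fun i => κ i := by
    intro κ hκ
    rw [hQ, map_sum, Finset.sum_eq_single_of_mem κ hκ]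
    · rw [map_mul, MvPolynomial.eval_C, eval_nodePoly, hM, ← Finset.mul_prod_erase _ _ hκ]
      simp only [hW, nodeProd]
      ring
    · intro κ' hκ' hne
      obtain ⟨i, hi⟩ := Function.ne_iff.1 hne.symm
      rw [map_mul, eval_nodePoly]
      refine mul_eq_zero_of_right _ (Finset.prod_eq_zero (Finset.mem_univ i) ?_)
      exact Finset.prod_eq_zero
        (Finset.mem_erase.2 ⟨hi, Fintype.mem_piFinset.1 hκ i⟩) (sub_self _)
  have hcast : ∀ n : Fin d → ℤ, MvPolynomial.eval (fun i => (n i : ℝ))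
      (MvPolynomial.map (Int.castRingHom ℝ) Q) = (MvPolynomial.eval n Q : ℤ) := fun n =>
    (MvPolynomial.map_eval (Int.castRingHom ℝ) n Q).symm
  have hPQ : MvPolynomial.C (M : ℝ) * P - MvPolynomial.map (Int.castRingHom ℝ) Q = 0 := by
    refine MvPolynomial.eq_zero_of_eval_zero_at_prod_finset _
      (fun _ => (Finset.range (s + 1)).image fun k : ℕ => (k : ℝ)) (fun i => ?_) fun x hx => ?_
    · rw [Finset.card_image_of_injective _ Nat.cast_injective, Finset.card_range, Nat.lt_succ_iff]
      refine (MvPolynomial.degreeOf_sub_le _ _ _).trans (max_le ?_ ?_)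
      · exact (MvPolynomial.degreeOf_C_mul_le _ _ _).trans
          ((MvPolynomial.degreeOf_le_totalDegree _ _).trans hP)
      · refine le_trans ?_ (hQdegOf i)
        classical
        rw [MvPolynomial.degreeOf_def, MvPolynomial.degreeOf_def]
        exact Multiset.count_le_of_le _ MvPolynomial.degrees_map_le
    · simp only [Finset.mem_image] at hx
      choose κ hκ hκx using hx
      obtain rfl : (fun i => (κ i : ℝ)) = x := funext hκx
      have h1 := hPg fun i => κ i
      have h2 := hcast fun i => κ i
      rw [hQgrid κ (Fintype.mem_piFinset.2 hκ)] at h2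
      push_cast at h1 h2
      rw [map_sub, map_mul, MvPolynomial.eval_C, h1, h2, sub_self]
  have hQe : ∀ n, MvPolynomial.eval n Q = M * g n := fun n => by
    have h1 := congrArg (MvPolynomial.eval fun i => (n i : ℝ)) hPQ
    rw [map_sub, map_mul, MvPolynomial.eval_C, hPg, hcast, map_zero, sub_eq_zero] at h1
    exact_mod_cast h1.symm
  refine ⟨MvPolynomial.C (M : ZMod p)⁻¹ * MvPolynomial.map (Int.castRingHom (ZMod p)) Q, ?_,
    fun n => ?_⟩
  · refine (MvPolynomial.totalDegree_mul _ _).trans ?_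
    rw [MvPolynomial.totalDegree_C, zero_add]
    exact (Finset.sup_mono (MvPolynomial.support_map_subset _ _)).trans hQdeg
  · have h := MvPolynomial.map_eval (Int.castRingHom (ZMod p)) n Q
    rw [hQe] at h
    rw [map_mul, MvPolynomial.eval_C]
    change _ * MvPolynomial.eval (Int.castRingHom (ZMod p) ∘ n) _ = _
    rw [← h]
    simp [hMp]

/-! ### The dichotomy for integer-valued polynomials -/

theorem e_intCast_div {p : ℕ} [Fact p.Prime] (k : ℤ) :
    e ((k : ℝ) / (p : ℝ)) = ZMod.stdAddChar (k : ZMod p) := by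
  rw [ZMod.stdAddChar_coe, e]
  congr 1
  push_cast
  ring

theorem coe_div_eq_of_intCast_eq {p : ℕ} [Fact p.Prime] {k l : ℤ}
    (h : (k : ZMod p) = (l : ZMod p)) :
    (((k : ℝ) / (p : ℝ) : ℝ) : AddCircle (1 : ℝ)) = (((l : ℝ) / (p : ℝ) : ℝ) : AddCircle (1 : ℝ)) := by
  have hp0 : (p : ℝ) ≠ 0 := by exact_mod_cast (Fact.out : p.Prime).ne_zero
  obtain ⟨c, hc⟩ := (ZMod.intCast_eq_intCast_iff_dvd_sub _ _ _).1 h.symm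
  rw [← sub_eq_zero, ← AddCircle.coe_sub, AddCircle.coe_eq_zero_iff]
  refine ⟨c, ?_⟩
  have hc' : (k : ℝ) - l = p * c := by exact_mod_cast hc
  rw [← sub_div, hc', mul_div_cancel_left₀ _ hp0, zsmul_eq_mul, mul_one]

/-- The numerical conclusion: if `p ≥ ((4 D + 9) / δ) ^ (4 ^ D)`, then the power saving for
polynomials of degree at most `D` is less than `δ` times the number of points. -/
theorem power_saving_lt {p n D N : ℕ} {δ : ℝ} (hp1 : 2 ≤ p) (hδ : 0 < δ)
    (hp : ((4 * D + 9 : ℕ) : ℝ) ^ ((2 : ℝ) ^ (D * 2)) * δ ^ (-(2 : ℝ) ^ (D * 2)) ≤ p)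
    (hN : (p - 1) * p ^ n ≤ N) :
    (2 * D + 2) * (p : ℝ) ^ n + p ^ (n + 1) * (2 * (p : ℝ) ^ (-(1 / 2 : ℝ) ^ (D * 2))) < δ * N := by
  have hp0 : (0 : ℝ) < p := by exact_mod_cast (by omega : 0 < p)
  have h1 : (1 : ℝ) ≤ p := by exact_mod_cast (by omega : 1 ≤ p)
  set C : ℝ := (2 : ℝ) ^ (D * 2) with hC
  have hC0 : 0 < C := by positivity
  have hCinv : (1 / 2 : ℝ) ^ (D * 2) = C⁻¹ := by rw [hC, one_div, inv_pow]
  set ε : ℝ := (p : ℝ) ^ (-(1 / 2 : ℝ) ^ (D * 2)) with hε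
  have hε0 : 0 < ε := by positivity
  have hεδ : (4 * D + 9) * ε ≤ δ := by
    have h2 := Real.rpow_le_rpow (by positivity) hp (inv_nonneg.2 hC0.le)
    rw [Real.mul_rpow (by positivity) (by positivity), ← Real.rpow_mul (by positivity),
      ← Real.rpow_mul hδ.le, neg_mul, mul_inv_cancel₀ hC0.ne', Real.rpow_one,
      Real.rpow_neg_one] at h2
    rw [hε, hCinv, Real.rpow_neg hp0.le, mul_inv_le_iff₀ (by positivity)]
    push_cast at h2
    rwa [← div_eq_mul_inv, div_le_iff₀ hδ, mul_comm _ δ] at h2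
  have hpε : 1 ≤ p * ε := by
    have h2 : (p : ℝ) ^ (-1 : ℝ) ≤ ε := by
      apply Real.rpow_le_rpow_of_exponent_le h1
      have : (1 / 2 : ℝ) ^ (D * 2) ≤ 1 := pow_le_one₀ (by norm_num) (by norm_num)
      linarith
    rwa [Real.rpow_neg_one, inv_le_iff_one_le_mul₀' hp0] at h2
  have hN' : (p : ℝ) ^ (n + 1) ≤ 2 * N := by
    have : p ^ (n + 1) ≤ 2 * N := by
      calc p ^ (n + 1) = p * p ^ n := by ring
        _ ≤ (2 * (p - 1)) * p ^ n := by gcongr; omega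
        _ ≤ 2 * N := by rw [mul_assoc]; gcongr
    exact_mod_cast this
  have hpn : (0 : ℝ) < p ^ n := by positivity
  have hN0 : (0 : ℝ) < N := by
    have : (0 : ℝ) < p ^ (n + 1) := by positivity
    linarith
  have h3 : (p : ℝ) ^ n ≤ p ^ (n + 1) * ε := by
    rw [pow_succ, mul_assoc]
    exact le_mul_of_one_le_right hpn.le hpε
  calc (2 * D + 2) * (p : ℝ) ^ n + p ^ (n + 1) * (2 * ε)
      ≤ (2 * D + 2) * (p ^ (n + 1) * ε) + p ^ (n + 1) * (2 * ε) := by gcongr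
    _ = (2 * D + 4) * ε * p ^ (n + 1) := by ring
    _ ≤ (2 * D + 4) * ε * (2 * N) := by gcongr
    _ < (4 * D + 9) * ε * N := by nlinarith [mul_pos hε0 hN0]
    _ ≤ δ * N := by gcongr

theorem corollary1 (d : ℕ) :
    ∃ K C : ℝ, 0 < K ∧ 0 < C ∧
      ∀ (s : ℕ), s + 13 ≤ d →
      ∀ (δ : ℝ), 0 < δ → δ < 1 / 2 →
      ∀ (p : ℕ) [Fact p.Prime], K * δ ^ (-C) ≤ (p : ℝ) →
      ∀ (g : (Fin d → ℤ) → ℤ), IsIntValuedPoly s g →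
      ∀ (r : ZMod p),
        (sphere p d r).Nonempty ∧
        (‖(1 / ((sphere p d r).card : ℂ)) *
            ∑ n ∈ sphere p d r, e ((g (tau n) : ℝ) / (p : ℝ))‖ < δ ∨
          ∃ c : AddCircle (1 : ℝ), ∀ n ∈ sphere p d r,
            (((g (tau n) : ℝ) / (p : ℝ) : ℝ) : AddCircle (1 : ℝ)) = c) := by
  set D := d * d with hD
  refine ⟨((4 * D + 9 : ℕ) : ℝ) ^ ((2 : ℝ) ^ (D * 2)), (2 : ℝ) ^ (D * 2), by positivity,
    by positivity, fun s hs δ hδ hδ2 p _ hp g hg r => ?_⟩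
  have hpD : 4 * D + 9 ≤ p := by
    have h1 : (1 : ℝ) ≤ 2 ^ (D * 2) := one_le_pow₀ (by norm_num)
    have h2 : ((4 * D + 9 : ℕ) : ℝ) ≤ ((4 * D + 9 : ℕ) : ℝ) ^ ((2 : ℝ) ^ (D * 2)) :=
      Real.self_le_rpow_of_one_le (by exact_mod_cast (by omega : 1 ≤ 4 * D + 9)) h1
    have h3 : 1 ≤ δ ^ (-(2 : ℝ) ^ (D * 2)) :=
      Real.one_le_rpow_of_pos_of_le_one_of_nonpos hδ (by linarith) (by linarith)
    have h4 : ((4 * D + 9 : ℕ) : ℝ) ≤ p :=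
      (h2.trans (le_mul_of_one_le_right (by positivity) h3)).trans hp
    exact_mod_cast h4
  have hdD : d ≤ D := Nat.le_mul_self d
  obtain ⟨f, hf, hfg⟩ := hg.exists_mvPolynomial_zmod (p := p) (by omega)
  have hf' : f.totalDegree ≤ D := hf.trans (Nat.mul_le_mul_left d (by omega))
  have hfτ : ∀ n : Fin d → ZMod p, (g (tau n) : ZMod p) = MvPolynomial.eval n f := fun n => by
    rw [← hfg]
    congr
    funext i
    simp [tau]
  obtain ⟨m, rfl⟩ : ∃ m, d = m + 3 := ⟨d - 3, by omega⟩
  obtain ⟨hcard, h⟩ := sphere_dichotomy (by omega) r f hf' (by omega) (by omega)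
  have hpos : 0 < (sphere p (m + 3) r).card :=
    lt_of_lt_of_le (Nat.mul_pos (by omega) (pow_pos (by omega) _)) hcard
  refine ⟨Finset.card_pos.1 hpos, h.imp (fun h => ?_) ?_⟩
  · simp only [e_intCast_div, hfτ]
    rw [norm_mul, norm_div, norm_one, Complex.norm_natCast, one_div_mul_eq_div,
      div_lt_iff₀ (by exact_mod_cast hpos)]
    exact h.trans_lt (power_saving_lt (by omega) hδ hp hcard)
  · rintro ⟨b, hb⟩
    obtain ⟨x, hx⟩ := Finset.card_pos.1 hpos
    refine ⟨_, fun n hn => coe_div_eq_of_intCast_eq (l := g (tau x)) ?_⟩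
    rw [hfτ, hfτ, hb n hn, hb x hx]
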